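/- Let $m$ be a prime and $n=2m>6$. Let $V=\mathbb F_2^{n}$ carry the standard nondegenerate alternating form, with isometry group $\mathrm{Sp}(n,2)$. A spread of $V$ is a set $\mathcal U$ of nonzero subspaces such that the sets $U\setminus\{0\}$, $U\in\mathcal U$, partition $V\setminus\{0\}$. Call it a regular symplectic spread if every $U\in\mathcal U$ is totally isotropic and, for some $\mathbb F_{2^m}$-vector space structure on $V$ extending its $\mathbb F_2$-structure, $\mathcal U$ is the set of all one-dimensional $\mathbb F_{2^m}$-subspaces of $V$. Write $\mathrm{Dye}_n=\{g\in \mathrm{Sp}(n,2): g\,\mathcal U=\mathcal U\}$ for the stabilizer of such a spread. Then $V$ has a regular symplectic spread, and for every regular symplectic spread $\mathcal U$ of $V$: (i) $\mathrm{Dye}_n\cong \mathrm{SL}(2,2^m)\rtimes C_m$, where a generator of the cyclic group $C_m$ of order $m$ acts on $\mathrm{SL}(2,2^m)$ by applying the Frobenius automorphism $x\mapsto x^2$ to the matrix entries; (ii) $\mathrm{Dye}_n$ is not a strong Gelfand subgroup of $\mathrm{Sp}(n,2)$: there are irreducible complex characters $\chi$ of $\mathrm{Sp}(n,2)$ and $\psi$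 of $\mathrm{Dye}_n$ with $\langle \psi,\chi|_{\mathrm{Dye}_n}\rangle>1$. -/

import Mathlib

open Matrix

noncomputable section

/-- `χ : G → ℂ` is the character of an irreducible finite-dimensional complex representation. -/
def IsIrreducibleCharacter {G : Type*} [Group G] (χ : G → ℂ) : Prop :=
  ∃ (W : Type) (_ : AddCommGroup W) (_ : Module ℂ W) (_ : FiniteDimensional ℂ W)
    (ρ : Representation ℂ G W), ρ.IsIrreducible ∧ ρ.character = χ

/-- The inner product `⟨φ, ψ⟩ = |H|⁻¹ ∑ h, φ h * conj (ψ h)` of complex functions on a finite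
group (the sum is `finsum`, which is the ordinary sum since the group is finite). -/
def characterInner {H : Type*} [Group H] [Finite H] (φ ψ : H → ℂ) : ℂ :=
  (Nat.card H : ℂ)⁻¹ * ∑ᶠ h : H, φ h * starRingEnd ℂ (ψ h)

/-- `H` is a strong Gelfand subgroup of the finite group `G`: `⟨ψ, χ|_H⟩ ≤ 1` for all irreducible
characters `χ` of `G` and `ψ` of `H`.  (These inner products are natural numbers, so the
comparison is made through the real part.) -/
def IsStrongGelfandSubgroup {G : Type*} [Group G] [Finite G] (H : Subgroup G) : Prop :=
  ∀ (χ : G → ℂ) (ψ : H → ℂ), IsIrreducibleCharacter χ → IsIrreducibleCharacter ψ →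
    (characterInner ψ (fun h : H => χ (h : G))).re ≤ 1

/-- The space `V = 𝔽₂ⁿ`, `n = 2m`, of column vectors, with coordinates indexed by two copies of
`Fin m`, on which the symplectic matrices act. -/
abbrev SympSpace (m : ℕ) : Type := Fin m ⊕ Fin m → ZMod 2

/-- The group `Sp(2m, 2)`: the matrices preserving the form `sympForm m` below. -/
abbrev Sp (m : ℕ) : Type := Matrix.symplecticGroup (Fin m) (ZMod 2)

/-- The standard nondegenerate alternating form on `𝔽₂^{2m}`. -/
def sympForm (m : ℕ) (x y : SympSpace m) : ZMod 2 :=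
  x ⬝ᵥ (Matrix.J (Fin m) (ZMod 2) *ᵥ y)

/-- `𝒰` is a spread: its members are nonzero subspaces and every nonzero vector lies in exactly
one of them; that is, the sets `U \ {0}`, `U ∈ 𝒰`, partition `V \ {0}`. -/
def IsSpread {V : Type*} [AddCommGroup V] [Module (ZMod 2) V]
    (𝒰 : Set (Submodule (ZMod 2) V)) : Prop :=
  ⊥ ∉ 𝒰 ∧ ∀ v : V, v ≠ 0 → ∃! U, U ∈ 𝒰 ∧ v ∈ U

/-- `𝒰` is a regular (Desarguesian) family of subspaces over `𝔽_{2^m}`: for some structure of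
`𝔽_{2^m}`-vector space on `V` extending the given `𝔽₂`-structure (an `𝔽₂`-algebra homomorphism
`ρ` from `𝔽_{2^m}` to `End V`), the members of `𝒰` are exactly the `𝔽_{2^m}`-lines
`{ρ a v : a ∈ 𝔽_{2^m}}`, `v ≠ 0`. -/
def IsRegularFamily (m : ℕ) {V : Type*} [AddCommGroup V] [Module (ZMod 2) V]
    (𝒰 : Set (Submodule (ZMod 2) V)) : Prop :=
  ∃ ρ : GaloisField 2 m →ₐ[ZMod 2] Module.End (ZMod 2) V,
    ∀ U : Submodule (ZMod 2) V,
      U ∈ 𝒰 ↔ ∃ v : V, v ≠ 0 ∧ (U : Set V) = Set.range (fun a : GaloisField 2 m => ρ a v)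

/-- A regular symplectic spread of `𝔽₂^{2m}`: a spread consisting of totally isotropic subspaces
that is the set of lines for some structure of `𝔽_{2^m}`-vector space. -/
structure IsRegularSymplecticSpread (m : ℕ) (𝒰 : Set (Submodule (ZMod 2) (SympSpace m))) :
    Prop where
  isSpread : IsSpread 𝒰
  isotropic : ∀ U ∈ 𝒰, ∀ x ∈ U, ∀ y ∈ U, sympForm m x y = 0
  regular : IsRegularFamily m 𝒰

/-- The image of a subspace under a symplectic matrix. -/
def sympImage {m : ℕ} (A : Sp m) (U : Submodule (ZMod 2) (SympSpace m)) :
    Submodule (ZMod 2) (SympSpace m) :=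
  U.map (Matrix.mulVecLin (A : Matrix (Fin m ⊕ Fin m) (Fin m ⊕ Fin m) (ZMod 2)))

theorem sympImage_one {m : ℕ} (U : Submodule (ZMod 2) (SympSpace m)) :
    sympImage (1 : Sp m) U = U := by
  simp [sympImage]

theorem sympImage_mul {m : ℕ} (A B : Sp m) (U : Submodule (ZMod 2) (SympSpace m)) :
    sympImage (A * B) U = sympImage A (sympImage B U) := by
  simp [sympImage, Matrix.mulVecLin_mul, Submodule.map_comp]

/-- The stabilizer in `Sp(2m, 2)` of a set of subspaces: for a regular symplectic spread with
`m` prime this is the group `Dye_{2m}`. -/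
def spreadStabilizer {m : ℕ} (𝒰 : Set (Submodule (ZMod 2) (SympSpace m))) : Subgroup (Sp m) where
  carrier := {A | ∀ U, sympImage A U ∈ 𝒰 ↔ U ∈ 𝒰}
  one_mem' := fun U => by rw [sympImage_one]
  mul_mem' := fun {A B} hA hB U => by rw [sympImage_mul, hA, hB]
  inv_mem' := fun {A} hA U => by
    rw [← hA (sympImage A⁻¹ U), ← sympImage_mul, mul_inv_cancel, sympImage_one]

/-- The group `SL(2, 2^m)`. -/
abbrev SL2 (m : ℕ) : Type := Matrix.SpecialLinearGroup (Fin 2) (GaloisField 2 m)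

/-- The Galois group of `𝔽_{2^m}` over `𝔽₂` acting on `SL(2, 2^m)` entrywise. -/
def galoisAction (m : ℕ) :
    (GaloisField 2 m ≃ₐ[ZMod 2] GaloisField 2 m) →* MulAut (SL2 m) where
  toFun σ :=
    { toFun := Matrix.SpecialLinearGroup.map (σ : GaloisField 2 m →+* GaloisField 2 m)
      invFun := Matrix.SpecialLinearGroup.map (σ.symm : GaloisField 2 m →+* GaloisField 2 m)
      left_inv := fun g => by ext i j; simp
      right_inv := fun g => by ext i j; simp
      map_mul' := fun g h => map_mul _ g h }
  map_one' := by ext g i j; simp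
  map_mul' := fun σ τ => by ext g i j; simp

/-- The Frobenius automorphism `x ↦ x²` of `𝔽_{2^m}`. -/
def frob (m : ℕ) : GaloisField 2 m ≃ₐ[ZMod 2] GaloisField 2 m :=
  FiniteField.frobeniusAlgEquivOfAlgebraic (ZMod 2) (GaloisField 2 m)

theorem frob_apply (m : ℕ) (x : GaloisField 2 m) : frob m x = x ^ 2 := by
  simp [frob]

theorem frob_pow (m : ℕ) (hm : m ≠ 0) : frob m ^ m = 1 := by
  have h := FiniteField.orderOf_frobeniusAlgEquivOfAlgebraic (ZMod 2) (GaloisField 2 m)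
  rw [GaloisField.finrank 2 hm] at h
  calc frob m ^ m = frob m ^ orderOf (frob m) := by rw [show orderOf (frob m) = m from h]
    _ = 1 := pow_orderOf_eq_one _

/-- The action of the cyclic group `C_m` on `SL(2, 2^m)` in which the generator acts as the
Frobenius automorphism. -/
def cyclicAction (m : ℕ) (hm : m ≠ 0) : Multiplicative (ZMod m) →* MulAut (SL2 m) :=
  (galoisAction m).comp
    (AddMonoidHom.toMultiplicativeLeft
      (ZMod.lift m ⟨zmultiplesHom _ (Additive.ofMul (frob m)), by
        simp [← ofMul_pow, frob_pow m hm]⟩))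

end

/-!
Over a field `F` with `2 ^ m` elements, a regular symplectic spread is, in suitable coordinates, the
set of lines of the plane `F²` with the form `Tr (x₀ y₁ - x₁ y₀)`: isotropy of the lines makes the
scalars self-adjoint (by polarization), and representing the trace on one line produces the second
basis vector (`IsRegularSymplecticSpread.exists_coordinates`). Conversely `F²` with this form is
isometric to the standard space, through a basis of `F` and its trace-dual basis
(`exists_isRegularSymplecticSpread`).

An additive bijection of `F²` that permutes the lines is semilinear (`exists_eq_semilinearMap`), and
one of the form `x ↦ A (σ x)` preserves the form if and only if `det A = 1`, because the trace form
is nondegenerate and Galois invariant. So the stabilizer is `SL(2, F) ⋊ Gal(F/𝔽₂)`.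

For the failure of the strong Gelfand property no character is computed. If all multiplicities are
at most one, then the operators that commute with `H` on an irreducible representation of `G`
commute with each other, hence so do the sums over two `H`-conjugacy orbits in `ℂ[G]`; therefore
every product `x * y` of elements of `G` can be rewritten as `y' * x'` with `y'` and `x'` conjugate
to `y` and `x` under `H` (`IsStrongGelfandSubgroup.exists_mul_eq_conj_mul_conj`). For the
shears `x : (p, q) ↦ (p + a q, q)` and `y : (p, q) ↦ (p, q + b p)` with `a`, `b` self-adjoint for the
trace form, `x'` fixes a line pointwise and `y' - 1` has its image in a line, so `x * y - 1` maps
the first of these lines into the second. This is impossible if `b` does not factor through `a` and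
`a (b + c) ≠ 0` for all scalars `c` (`IsSpreadCoordinates.not_isStrongGelfandSubgroup`). An operator
`a` of rank three and `b p = p ^ 2 + √p` satisfy these conditions when `m ≥ 5` is odd
(`exists_isTraceSelfAdjoint_pair`).
-/

noncomputable section

/-! ### Complex characters and the strong Gelfand property -/

open Representation in
open scoped ComplexOrder in
/-- The values of a character of a finite group at `g` and `g⁻¹` are complex conjugate: in a
basis, the matrices `M h` of the representation leave the positive definite form
`∑ h, (M h)ᴴ * M h` invariant, so `(M g)ᴴ` is conjugate to `M g⁻¹`. -/
theorem Representation.character_inv_eq_conj {G W : Type*} [Group G] [Finite G] [AddCommGroup W]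
    [Module ℂ W] [FiniteDimensional ℂ W] (ρ : Representation ℂ G W) (g : G) :
    ρ.character g⁻¹ = starRingEnd ℂ (ρ.character g) := by
  classical
  have := Fintype.ofFinite G
  let b := Module.finBasis ℂ W
  let M : G → Matrix (Fin (Module.finrank ℂ W)) (Fin (Module.finrank ℂ W)) ℂ :=
    fun h => LinearMap.toMatrix b b (ρ h)
  have hM : ∀ h k, M (h * k) = M h * M k := fun h k => by
    simp [M, map_mul, LinearMap.toMatrix_mul]
  have hM1 : M 1 = 1 := by simp [M, LinearMap.toMatrix_one]
  have htr : ∀ h, ρ.character h = (M h).trace := fun h => by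
    rw [character, LinearMap.trace_eq_matrix_trace ℂ b]
  let P := ∑ h : G, (M h)ᴴ * M h
  have hP : P.PosDef := by
    have hP' : P = (∑ h ∈ Finset.univ.erase (1 : G), (M h)ᴴ * M h) + 1 := by
      rw [show P = ∑ h : G, (M h)ᴴ * M h from rfl,
        ← Finset.sum_erase_add _ _ (Finset.mem_univ (1 : G))]
      simp [hM1]
    rw [hP']
    exact Matrix.PosDef.posSemidef_add
      (Matrix.posSemidef_sum _ fun h _ => Matrix.posSemidef_conjTranspose_mul_self _) Matrix.PosDef.one
  have hinv : (M g)ᴴ * P * M g = P := by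
    simp only [P, Finset.mul_sum, Finset.sum_mul]
    refine Fintype.sum_equiv (Equiv.mulRight g) _ _ fun h => ?_
    simp [hM, Matrix.conjTranspose_mul, Matrix.mul_assoc]
  have hdet : IsUnit P.det := (Matrix.isUnit_iff_isUnit_det _).1 hP.isUnit
  have hgg : M g * M g⁻¹ = 1 := by rw [← hM, mul_inv_cancel, hM1]
  have hP1 : (M g)ᴴ * P = P * M g⁻¹ := by
    calc (M g)ᴴ * P = (M g)ᴴ * P * (M g * M g⁻¹) := by rw [hgg, mul_one]
      _ = ((M g)ᴴ * P * M g) * M g⁻¹ := by simp only [Matrix.mul_assoc]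
      _ = P * M g⁻¹ := by rw [hinv]
  have hP2 : (M g)ᴴ = P * M g⁻¹ * P⁻¹ := by
    rw [← hP1, Matrix.mul_assoc, Matrix.mul_nonsing_inv _ hdet, mul_one]
  rw [htr, htr, starRingEnd_apply, ← Matrix.trace_conjTranspose, hP2, Matrix.mul_assoc,
    Matrix.trace_mul_comm, Matrix.mul_assoc, Matrix.nonsing_inv_mul _ hdet, mul_one]

theorem characterInner_eq_finrank {H U W : Type*} [Group H] [Finite H] [AddCommGroup U]
    [Module ℂ U] [FiniteDimensional ℂ U] [AddCommGroup W] [Module ℂ W] [FiniteDimensional ℂ W]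
    (σ : Representation ℂ H U) (ρ : Representation ℂ H W) :
    characterInner σ.character ρ.character =
      Module.finrank ℂ (Representation.IntertwiningMap ρ σ) := by
  have := Fintype.ofFinite H
  have : Invertible (Nat.card H : ℂ) :=
    invertibleOfNonzero (Nat.cast_ne_zero.2 Nat.card_pos.ne')
  rw [← Representation.card_inv_mul_sum_char_mul_char_eq_finrank, characterInner,
    finsum_eq_sum_of_fintype]
  simp only [Representation.character_inv_eq_conj]

/-- By semisimplicity, the irreducible quotients of a representation of a finite group separate
its vectors. -/
theorem Representation.exists_isIrreducible_apply_ne_zero {G W : Type} [Group G] [Finite G]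
    [AddCommGroup W] [Module ℂ W] [FiniteDimensional ℂ W] (ρ : Representation ℂ G W) {w : W}
    (hw : w ≠ 0) :
    ∃ (U : Type) (_ : AddCommGroup U) (_ : Module ℂ U) (_ : FiniteDimensional ℂ U)
      (σ : Representation ℂ G U) (p : IntertwiningMap ρ σ), σ.IsIrreducible ∧ p w ≠ 0 := by
  have hj := IsSemisimpleModule.jacobson_eq_bot (MonoidAlgebra ℂ G) ρ.asModule
  have hw' : ρ.asModuleEquiv.symm w ∉ Module.jacobson (MonoidAlgebra ℂ G) ρ.asModule := by
    rw [hj]; simpa using hw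
  rw [Module.jacobson, Submodule.mem_sInf] at hw'
  push Not at hw'
  obtain ⟨N, hN, hwN⟩ := hw'
  have hs : IsSimpleModule (MonoidAlgebra ℂ G) (ρ.asModule ⧸ N) := isSimpleModule_iff_isCoatom.2 hN
  let σ : Representation ℂ G (ρ.asModule ⧸ N) := ofModule' (ρ.asModule ⧸ N)
  have hsmul : ∀ (a : MonoidAlgebra ℂ G) (u : ρ.asModule ⧸ N), σ.asAlgebraHom a u = a • u := by
    intro a u
    simp [σ, ofModule', asAlgebraHom]
  let e : σ.asModule ≃ₗ[MonoidAlgebra ℂ G] ρ.asModule ⧸ N :=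
    { σ.asModuleEquiv with
      map_smul' := fun a u => (σ.asModuleEquiv_map_smul a u).trans (hsmul a _) }
  let p : W →ₗ[ℂ] ρ.asModule ⧸ N :=
    (N.mkQ.restrictScalars ℂ).comp ρ.asModuleEquiv.symm.toLinearMap
  refine ⟨ρ.asModule ⧸ N, inferInstance, inferInstance, inferInstance, σ,
    p.intertwiningMap_of_isIntertwiningMap _ _ fun g v => ?_,
    (irreducible_iff_isSimpleModule_asModule σ).2 (IsSimpleModule.congr e), fun h => ?_⟩
  · rw [← asAlgebraHom_single_one σ, hsmul]
    change N.mkQ (ρ.asModuleEquiv.symm (ρ g v)) = _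
    rw [asModuleEquiv_symm_map_rho, map_smul]
    rfl
  · exact hwN ((Submodule.Quotient.mk_eq_zero N).1 h)

/-- If every irreducible representation has multiplicity at most one in `ρ`, the endomorphisms
of `ρ` act as scalars on each irreducible quotient and hence commute. -/
theorem Representation.IntertwiningMap.comp_comm_of_finrank_le_one {H W : Type} [Group H]
    [Finite H] [AddCommGroup W] [Module ℂ W] [FiniteDimensional ℂ W] (ρ : Representation ℂ H W)
    (hρ : ∀ (U : Type) (_ : AddCommGroup U) (_ : Module ℂ U) (_ : FiniteDimensional ℂ U)
      (σ : Representation ℂ H U), σ.IsIrreducible →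
        Module.finrank ℂ (IntertwiningMap ρ σ) ≤ 1)
    (f g : IntertwiningMap ρ ρ) (w : W) : f (g w) = g (f w) := by
  by_contra hne
  obtain ⟨U, _, _, _, σ, p, hσ, hp⟩ :=
    ρ.exists_isIrreducible_apply_ne_zero (sub_ne_zero.2 hne)
  obtain ⟨q, hq⟩ := finrank_le_one_iff.1 (hρ U _ _ inferInstance σ hσ)
  obtain ⟨a, rfl⟩ := hq p
  obtain ⟨c, hc⟩ := hq (q.comp f)
  obtain ⟨d, hd⟩ := hq (q.comp g)
  have hc' : ∀ v, q (f v) = c • q v := fun v => by rw [← IntertwiningMap.comp_apply, ← hc]; rfl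
  have hd' : ∀ v, q (g v) = d • q v := fun v => by rw [← IntertwiningMap.comp_apply, ← hd]; rfl
  apply hp
  change a • q _ = 0
  rw [map_sub, hc', hd', hd', hc', smul_smul, smul_smul, mul_comm, sub_self, smul_zero]


/-- The sum of the operators of the `H`-conjugates `h * x * h⁻¹` of `x`. -/
def Representation.conjSum {G W : Type*} [Group G] [Finite G] [AddCommGroup W] [Module ℂ W]
    (ρ : Representation ℂ G W) (H : Subgroup G) (x : G) : W →ₗ[ℂ] W :=
  ∑ᶠ h : H, ρ (h * x * (h : G)⁻¹)

theorem Representation.conjSum_apply {G W : Type*} [Group G] [Finite G] [AddCommGroup W]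
    [Module ℂ W] (ρ : Representation ℂ G W) (H : Subgroup G) [Fintype H] (x : G) (w : W) :
    ρ.conjSum H x w = ∑ h : H, ρ (h * x * (h : G)⁻¹) w := by
  rw [conjSum, finsum_eq_sum_of_fintype, LinearMap.sum_apply]

/-- The operator `conjSum` commutes with the action of `H`. -/
def Representation.conjSumIntertwining {G W : Type*} [Group G] [Finite G] [AddCommGroup W]
    [Module ℂ W] (ρ : Representation ℂ G W) (H : Subgroup G) (x : G) :
    IntertwiningMap (ρ.comp H.subtype) (ρ.comp H.subtype) :=
  (ρ.conjSum H x).intertwiningMap_of_isIntertwiningMap _ _ fun k w => by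
    have := Fintype.ofFinite H
    simp only [conjSum_apply, map_sum]
    refine Fintype.sum_equiv (Equiv.mulLeft k⁻¹) _ _ fun h => ?_
    simp only [MonoidHom.comp_apply, ← Module.End.mul_apply, ← map_mul]
    congr 2
    simp [mul_assoc]

/-- If `H` is a strong Gelfand subgroup, the subalgebra of `ℂ[G]` centralized by `H` is
commutative; comparing the coefficients of `x * y` in two products of sums over `H`-conjugates
gives this consequence for elements of `G`. -/
theorem IsStrongGelfandSubgroup.exists_mul_eq_conj_mul_conj {G : Type} [Group G] [Finite G]
    {H : Subgroup G} (hH : IsStrongGelfandSubgroup H) (x y : G) :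
    ∃ h ∈ H, ∃ k ∈ H, x * y = (h * y * h⁻¹) * (k * x * k⁻¹) := by
  classical
  by_contra! hne
  have := Fintype.ofFinite H
  let reg := Representation.leftRegular ℂ G
  let e : MonoidAlgebra ℂ G := MonoidAlgebra.single 1 1
  have hmul : ∀ a b : G, reg.conjSum H a (reg.conjSum H b e) =
      ∑ h : H, ∑ k : H,
        MonoidAlgebra.single ((h * a * (h : G)⁻¹) * (k * b * (k : G)⁻¹)) (1 : ℂ) := fun a b => by
    rw [Finset.sum_comm]
    simp [Representation.conjSum_apply, reg, e, mul_assoc]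
  -- The coefficients of `x * y` in the two products are positive and zero, respectively.
  have hcoeff : reg.conjSum H x (reg.conjSum H y e) - reg.conjSum H y (reg.conjSum H x e) ≠ 0 := by
    intro h0
    have h1 := congrArg (fun f : MonoidAlgebra ℂ G => f.coeff (x * y)) (sub_eq_zero.1 h0)
    simp only [hmul, MonoidAlgebra.coeff_sum, MonoidAlgebra.coeff_single, Finsupp.finsetSum_apply,
      Finsupp.single_apply] at h1
    rw [Finset.sum_eq_zero (s := Finset.univ) (f := fun h : H => ∑ k : H, if
      (h * y * (h : G)⁻¹) * (k * x * (k : G)⁻¹) = x * y then (1 : ℂ) else 0) fun h _ =>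
        Finset.sum_eq_zero fun k _ => if_neg (hne h h.2 k k.2).symm] at h1
    have h2 : (∑ h : H, ∑ k : H,
        if (h * x * (h : G)⁻¹) * (k * y * (k : G)⁻¹) = x * y then 1 else 0) = 0 := by
      exact_mod_cast h1
    simp only [Finset.sum_eq_zero_iff, Finset.mem_univ, true_implies] at h2
    simpa using h2 1 1
  obtain ⟨W, _, _, _, ρ, p, hρ, hp⟩ := reg.exists_isIrreducible_apply_ne_zero hcoeff
  have hpc : ∀ a v, p (reg.conjSum H a v) = ρ.conjSum H a (p v) := fun a v => by
    simp only [Representation.conjSum_apply, map_sum, p.isIntertwining]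
  rw [map_sub, hpc, hpc, hpc, hpc, sub_ne_zero] at hp
  refine hp (Representation.IntertwiningMap.comp_comm_of_finrank_le_one (ρ.comp H.subtype) ?_
    (ρ.conjSumIntertwining H x) (ρ.conjSumIntertwining H y) (p e))
  intro U _ _ _ σ hσ
  have h1 := hH ρ.character σ.character ⟨W, _, _, inferInstance, ρ, hρ, rfl⟩
    ⟨U, _, _, inferInstance, σ, hσ, rfl⟩
  rw [show (fun h : H => ρ.character (h : G)) =
    Representation.character (ρ.comp H.subtype) from rfl, characterInner_eq_finrank] at h1
  exact_mod_cast h1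

/-! ### Coordinates for regular symplectic spreads -/

/-- The `𝔽₂`-valued alternating form `Tr (x₀ y₁ - x₁ y₀)` on the plane `𝔽_{2^m}²`. -/
def traceDetForm (m : ℕ) (x y : Fin 2 → GaloisField 2 m) : ZMod 2 :=
  Algebra.trace (ZMod 2) (GaloisField 2 m) (x 0 * y 1 - x 1 * y 0)

/-- Coordinates for a family `𝒰` of subspaces: a linear isomorphism of the plane `𝔽_{2^m}²` with
`𝔽₂^{2m}` that transports the form `traceDetForm` to the standard alternating form and the
`𝔽_{2^m}`-lines to the members of `𝒰`. -/
structure IsSpreadCoordinates {m : ℕ} (𝒰 : Set (Submodule (ZMod 2) (SympSpace m)))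
    (φ : (Fin 2 → GaloisField 2 m) ≃ₗ[ZMod 2] SympSpace m) : Prop where
  sympForm_apply : ∀ x y, sympForm m (φ x) (φ y) = traceDetForm m x y
  mem_iff : ∀ U : Submodule (ZMod 2) (SympSpace m),
    U ∈ 𝒰 ↔ ∃ v, v ≠ 0 ∧ (U : Set (SympSpace m)) = Set.range fun a : GaloisField 2 m => φ (a • v)

theorem GaloisField.eq_zero_of_trace_mul_eq_zero {m : ℕ} {x : GaloisField 2 m}
    (h : ∀ y, Algebra.trace (ZMod 2) (GaloisField 2 m) (x * y) = 0) : x = 0 :=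
  (traceForm_nondegenerate (ZMod 2) (GaloisField 2 m)).1 x h

theorem traceDetForm_nondegenerate {m : ℕ} {x : Fin 2 → GaloisField 2 m}
    (h : ∀ y, traceDetForm m x y = 0) : x = 0 := by
  have h0 : x 0 = 0 := GaloisField.eq_zero_of_trace_mul_eq_zero fun z => by
    simpa [traceDetForm] using h ![0, z]
  have h1 : x 1 = 0 := GaloisField.eq_zero_of_trace_mul_eq_zero fun z => by
    simpa [traceDetForm] using h ![z, 0]
  ext i
  fin_cases i <;> simp [h0, h1]

theorem sympForm_eq_sum (m : ℕ) (x y : SympSpace m) :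
    sympForm m x y =
      (∑ i, x (Sum.inl i) * y (Sum.inr i)) - ∑ i, x (Sum.inr i) * y (Sum.inl i) := by
  simp only [sympForm, Matrix.J, Matrix.fromBlocks_mulVec, dotProduct, Fintype.sum_sum_type]
  simp [Function.comp_def, CharTwo.sub_eq_add, Matrix.neg_mulVec, CharTwo.neg_eq]

theorem sympForm_add_left (m : ℕ) (x y z : SympSpace m) :
    sympForm m (x + y) z = sympForm m x z + sympForm m y z := by
  simp [sympForm, add_dotProduct]

theorem sympForm_add_right (m : ℕ) (x y z : SympSpace m) :
    sympForm m x (y + z) = sympForm m x y + sympForm m x z := by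
  simp [sympForm, Matrix.mulVec_add, dotProduct_add]

theorem sympForm_comm (m : ℕ) (x y : SympSpace m) : sympForm m x y = sympForm m y x := by
  simp only [sympForm_eq_sum, CharTwo.sub_eq_add, mul_comm]
  rw [add_comm]

theorem exists_sympForm_eq (m : ℕ) (ℓ : SympSpace m →ₗ[ZMod 2] ZMod 2) :
    ∃ y, ∀ x, sympForm m x y = ℓ x := by
  refine ⟨Matrix.J (Fin m) (ZMod 2) *ᵥ fun i => ℓ fun j => if i = j then 1 else 0, fun x => ?_⟩
  rw [sympForm, Matrix.mulVec_mulVec, Matrix.J_squared, Matrix.neg_mulVec, Matrix.one_mulVec,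
    LinearMap.pi_apply_eq_sum_univ ℓ x]
  simp [dotProduct, CharTwo.neg_eq]

/-- A linear map between the two symplectic spaces that preserves the forms is injective by
nondegeneracy, and bijective because both have `2 ^ (2 * m)` elements. -/
theorem bijective_of_sympForm_eq {m : ℕ} (hm : m ≠ 0)
    (φ : (Fin 2 → GaloisField 2 m) →ₗ[ZMod 2] SympSpace m)
    (hφ : ∀ x y, sympForm m (φ x) (φ y) = traceDetForm m x y) : Function.Bijective φ := by
  have hinj : Function.Injective φ := by
    rw [injective_iff_map_eq_zero]
    intro x hx
    refine traceDetForm_nondegenerate fun y => ?_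
    rw [← hφ, hx]
    simp [sympForm]
  refine ⟨hinj, (LinearMap.injective_iff_surjective_of_finrank_eq_finrank ?_).1 hinj⟩
  rw [Module.finrank_pi_fintype, Module.finrank_pi]
  simp [GaloisField.finrank 2 hm, two_mul]

theorem exists_linearEquiv_sympForm_eq {m : ℕ} (hm : m ≠ 0) :
    ∃ φ : (Fin 2 → GaloisField 2 m) ≃ₗ[ZMod 2] SympSpace m,
      ∀ x y, sympForm m (φ x) (φ y) = traceDetForm m x y := by
  let b : Module.Basis (Fin m) (ZMod 2) (GaloisField 2 m) :=
    Module.finBasisOfFinrankEq _ _ (GaloisField.finrank 2 hm)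
  -- The second half of the coordinates is taken with respect to the trace-dual basis of `b`.
  let φ : (Fin 2 → GaloisField 2 m) →ₗ[ZMod 2] SympSpace m :=
    { toFun := fun x => Sum.elim (fun i => b.repr (x 0) i)
        (fun i => Algebra.trace (ZMod 2) (GaloisField 2 m) (b i * x 1))
      map_add' := fun x y => by ext (i | i) <;> simp [mul_add]
      map_smul' := fun c x => by ext (i | i) <;> simp }
  have key : ∀ u v : GaloisField 2 m, ∑ i, b.repr u i *
      Algebra.trace (ZMod 2) (GaloisField 2 m) (b i * v) =
        Algebra.trace (ZMod 2) (GaloisField 2 m) (u * v) := fun u v => by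
    conv_rhs => rw [← b.sum_repr u, Finset.sum_mul, map_sum]
    simp only [smul_mul_assoc, map_smul, smul_eq_mul]
  have hφ : ∀ x y, sympForm m (φ x) (φ y) = traceDetForm m x y := fun x y => by
    rw [sympForm_eq_sum, traceDetForm, map_sub, ← key, mul_comm (x 1), ← key]
    simp [φ, mul_comm]
  exact ⟨LinearEquiv.ofBijective φ (bijective_of_sympForm_eq hm φ hφ), hφ⟩

theorem traceDetForm_smul_smul {m : ℕ} (a b : GaloisField 2 m) (v : Fin 2 → GaloisField 2 m) :
    traceDetForm m (a • v) (b • v) = 0 := by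
  rw [traceDetForm]
  convert map_zero (Algebra.trace (ZMod 2) (GaloisField 2 m)) using 2
  simp only [Pi.smul_apply, smul_eq_mul]
  ring

/-- The spread consists of the images of the `𝔽_{2^m}`-lines under an isometry from the plane
`𝔽_{2^m}²`. -/
theorem exists_isRegularSymplecticSpread {m : ℕ} (hm : m ≠ 0) :
    ∃ 𝒰 : Set (Submodule (ZMod 2) (SympSpace m)), IsRegularSymplecticSpread m 𝒰 := by
  obtain ⟨φ, hφ⟩ := exists_linearEquiv_sympForm_eq hm
  refine ⟨{U | ∃ v, v ≠ 0 ∧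
    (U : Set (SympSpace m)) = Set.range fun a : GaloisField 2 m => φ (a • v)}, ⟨?_, ?_⟩, ?_, ?_⟩
  · rintro ⟨v, hv, h⟩
    have h1 : φ ((1 : GaloisField 2 m) • v) ∈ (⊥ : Submodule (ZMod 2) (SympSpace m)) := by
      rw [← SetLike.mem_coe, h]; exact ⟨1, rfl⟩
    simp [hv] at h1
  · intro w hw
    let L : GaloisField 2 m →ₗ[ZMod 2] SympSpace m :=
      φ.toLinearMap.comp (LinearMap.toSpanSingleton (GaloisField 2 m) _
        (φ.symm w) |>.restrictScalars (ZMod 2))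
    refine ⟨LinearMap.range L, ⟨⟨φ.symm w, by simpa using hw, by ext; simp [L]⟩,
      ⟨1, by simp [L]⟩⟩, ?_⟩
    rintro U ⟨⟨v, hv, hU⟩, hwU⟩
    rw [← SetLike.mem_coe, hU] at hwU
    obtain ⟨a, rfl⟩ := hwU
    have ha : a ≠ 0 := by rintro rfl; simp at hw
    ext z
    rw [← SetLike.mem_coe, hU]
    simp only [Set.mem_range, LinearMap.mem_range, L]
    constructor
    · rintro ⟨c, rfl⟩
      exact ⟨c * a⁻¹, by simp [smul_smul, ha]⟩
    · rintro ⟨c, rfl⟩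
      exact ⟨c * a, by simp [smul_smul]⟩
  · rintro U ⟨v, -, hU⟩ x hx y hy
    rw [← SetLike.mem_coe, hU] at hx hy
    obtain ⟨a, rfl⟩ := hx
    obtain ⟨b, rfl⟩ := hy
    rw [hφ, traceDetForm_smul_smul]
  · refine ⟨(φ.conjAlgEquiv (ZMod 2)).toAlgHom.comp
      (Algebra.lsmul (ZMod 2) (ZMod 2) (Fin 2 → GaloisField 2 m)), fun U => ?_⟩
    constructor
    · rintro ⟨v, hv, hU⟩
      exact ⟨φ v, by simpa using hv, by rw [hU]; simp⟩
    · rintro ⟨v, hv, hU⟩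
      exact ⟨φ.symm v, by simpa using hv, by rw [hU]; simp⟩

/-- The first basis vector `e₁` is arbitrary and `e₂` represents the functional `a • e₁ ↦ Tr a`, so
that the form takes the value `Tr (a * b)` on `a • e₁` and `b • e₂`. -/
theorem IsRegularSymplecticSpread.exists_coordinates {m : ℕ} (hm : m ≠ 0)
    {𝒰 : Set (Submodule (ZMod 2) (SympSpace m))} (h𝒰 : IsRegularSymplecticSpread m 𝒰) :
    ∃ φ, IsSpreadCoordinates 𝒰 φ := by
  obtain ⟨ρ, hρ⟩ := h𝒰.regular
  have hiso : ∀ v a b, sympForm m (ρ a v) (ρ b v) = 0 := by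
    intro v a b
    by_cases hv : v = 0
    · simp [hv, sympForm]
    · let U : Submodule (ZMod 2) (SympSpace m) :=
        LinearMap.range ((LinearMap.applyₗ v).comp ρ.toLinearMap)
      exact h𝒰.isotropic U ((hρ U).2 ⟨v, hv, by ext; simp [U]⟩) _ ⟨a, rfl⟩ _ ⟨b, rfl⟩
  -- Polarization of the isotropy condition: the scalars are self-adjoint.
  have hadj : ∀ a v w, sympForm m (ρ a v) w = sympForm m v (ρ a w) := by
    intro a v w
    have h := hiso (v + w) a 1
    simp only [map_one, Module.End.one_apply, map_add, sympForm_add_left, sympForm_add_right] at h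
    have h1 := hiso v a 1
    have h2 := hiso w a 1
    simp only [map_one, Module.End.one_apply] at h1 h2
    rw [h1, h2, zero_add, add_zero, sympForm_comm m (ρ a w)] at h
    exact (CharTwo.add_eq_zero.1 h).symm
  obtain ⟨e₁, he₁⟩ : ∃ e₁ : SympSpace m, e₁ ≠ 0 := by
    have : Nonempty (Fin m) := ⟨⟨0, Nat.pos_of_ne_zero hm⟩⟩
    exact exists_ne 0
  have hinv : ∀ {a : GaloisField 2 m}, a ≠ 0 → ∀ v, ρ a⁻¹ (ρ a v) = v := fun ha v => by
    rw [← Module.End.mul_apply, ← map_mul, inv_mul_cancel₀ ha, map_one, Module.End.one_apply]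
  have hinj : LinearMap.ker ((LinearMap.applyₗ e₁).comp ρ.toLinearMap) = ⊥ := by
    rw [LinearMap.ker_eq_bot']
    intro a ha
    by_contra ha0
    apply he₁
    rw [← hinv ha0 e₁]
    exact (congrArg (ρ a⁻¹) ha).trans (map_zero _)
  -- The second basis vector represents the trace on the line of the first.
  obtain ⟨g, hg⟩ := LinearMap.exists_leftInverse_of_injective _ hinj
  obtain ⟨e₂, he₂⟩ := exists_sympForm_eq m
    ((Algebra.trace (ZMod 2) (GaloisField 2 m)).comp g)
  have he₂' : ∀ a, sympForm m (ρ a e₁) e₂ = Algebra.trace (ZMod 2) (GaloisField 2 m) a := by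
    intro a
    rw [he₂]
    exact congrArg (Algebra.trace (ZMod 2) (GaloisField 2 m)) (LinearMap.congr_fun hg a)
  have hmul : ∀ a b, sympForm m (ρ a e₁) (ρ b e₂) =
      Algebra.trace (ZMod 2) (GaloisField 2 m) (a * b) := fun a b => by
    rw [← hadj, ← Module.End.mul_apply, ← map_mul, he₂', mul_comm]
  let φ : (Fin 2 → GaloisField 2 m) →ₗ[ZMod 2] SympSpace m :=
    { toFun := fun x => ρ (x 0) e₁ + ρ (x 1) e₂
      map_add' := fun x y => by simp; abel
      map_smul' := fun c x => by simp }
  have hφ : ∀ x y, sympForm m (φ x) (φ y) = traceDetForm m x y := fun x y => by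
    change sympForm m (ρ (x 0) e₁ + ρ (x 1) e₂) (ρ (y 0) e₁ + ρ (y 1) e₂) = _
    rw [sympForm_add_left, sympForm_add_right, sympForm_add_right, hiso, hiso, hmul,
      sympForm_comm m (ρ (x 1) e₂), hmul, traceDetForm, CharTwo.sub_eq_add, map_add,
      mul_comm (x 1), zero_add, add_zero]
  have hsmul : ∀ a x, φ (a • x) = ρ a (φ x) := fun a x => by
    change ρ (a * x 0) e₁ + ρ (a * x 1) e₂ = ρ a (ρ (x 0) e₁ + ρ (x 1) e₂)
    simp
  let ψ := LinearEquiv.ofBijective φ (bijective_of_sympForm_eq hm φ hφ)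
  refine ⟨ψ, hφ, fun U => (hρ U).trans ⟨?_, ?_⟩⟩
  · rintro ⟨v, hv, hU⟩
    refine ⟨ψ.symm v, by simpa using hv, ?_⟩
    rw [hU]
    congr 1
    funext a
    exact ((hsmul a (ψ.symm v)).trans (congrArg (ρ a) (ψ.apply_symm_apply v))).symm
  · rintro ⟨v, hv, hU⟩
    refine ⟨ψ v, by simpa using hv, ?_⟩
    rw [hU]
    congr 1
    funext a
    exact hsmul a v

/-! ### The stabilizer of a regular symplectic spread -/

theorem sympForm_mulVec {m : ℕ} (A : Sp m) (x y : SympSpace m) :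
    sympForm m (A.1 *ᵥ x) (A.1 *ᵥ y) = sympForm m x y := by
  have h := SymplecticGroup.mem_iff'.1 A.2
  rw [sympForm, sympForm, ← Matrix.vecMul_transpose, ← Matrix.dotProduct_mulVec,
    Matrix.mulVec_mulVec, Matrix.mulVec_mulVec, h]

theorem Sp.mul_mulVec {m : ℕ} (A B : Sp m) (x : SympSpace m) :
    (A * B).1 *ᵥ x = A.1 *ᵥ (B.1 *ᵥ x) := by
  rw [Submonoid.coe_mul, Matrix.mulVec_mulVec]

theorem Sp.inv_mulVec_mulVec {m : ℕ} (A : Sp m) (x : SympSpace m) :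
    A⁻¹.1 *ᵥ (A.1 *ᵥ x) = x := by
  rw [← Sp.mul_mulVec, inv_mul_cancel, Submonoid.coe_one, Matrix.one_mulVec]

theorem Sp.mulVec_inv_mulVec {m : ℕ} (A : Sp m) (x : SympSpace m) :
    A.1 *ᵥ (A⁻¹.1 *ᵥ x) = x := by
  rw [← Sp.mul_mulVec, mul_inv_cancel, Submonoid.coe_one, Matrix.one_mulVec]

theorem Sp.mulVec_injective {m : ℕ} (A : Sp m) : Function.Injective (A.1 *ᵥ ·) :=
  Function.LeftInverse.injective A.inv_mulVec_mulVec

/-- The symplectic matrix of a linear isometry of `𝔽₂^{2m}`. -/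
def Sp.ofLinearMap {m : ℕ} (g : SympSpace m →ₗ[ZMod 2] SympSpace m)
    (hg : ∀ x y, sympForm m (g x) (g y) = sympForm m x y) : Sp m :=
  ⟨LinearMap.toMatrix' g, SymplecticGroup.mem_iff'.2 <| by
    refine Matrix.ext_of_mulVec_single fun j => ?_
    refine dotProduct_eq _ _ fun x => ?_
    rw [dotProduct_comm, dotProduct_comm _ x, Matrix.mul_assoc, ← Matrix.mulVec_mulVec,
      Matrix.dotProduct_mulVec, Matrix.vecMul_transpose, ← Matrix.mulVec_mulVec]
    rw [LinearMap.toMatrix'_mulVec, LinearMap.toMatrix'_mulVec]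
    exact hg x (Pi.single j 1)⟩

@[simp]
theorem Sp.ofLinearMap_mulVec {m : ℕ} (g : SympSpace m →ₗ[ZMod 2] SympSpace m)
    (hg : ∀ x y, sympForm m (g x) (g y) = sympForm m x y) (x : SympSpace m) :
    (Sp.ofLinearMap g hg).1 *ᵥ x = g x := by
  simp [Sp.ofLinearMap]

theorem Sp.ext_mulVec {m : ℕ} {A B : Sp m} (h : ∀ x, A.1 *ᵥ x = B.1 *ᵥ x) : A = B :=
  Subtype.ext (Matrix.ext_of_mulVec_single fun _ => h _)

/-- The homomorphism `C_m → Gal(𝔽_{2^m}/𝔽₂)` underlying `cyclicAction`, which sends the generator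
to the Frobenius automorphism; it is an isomorphism by `cyclicToGalois_bijective`. -/
def cyclicToGalois (m : ℕ) (hm : m ≠ 0) :
    Multiplicative (ZMod m) →* (GaloisField 2 m ≃ₐ[ZMod 2] GaloisField 2 m) :=
  AddMonoidHom.toMultiplicativeLeft
    (ZMod.lift m ⟨zmultiplesHom _ (Additive.ofMul (frob m)), by
      simp [← ofMul_pow, frob_pow m hm]⟩)

theorem cyclicAction_apply (m : ℕ) (hm : m ≠ 0) (c : Multiplicative (ZMod m)) :
    cyclicAction m hm c = galoisAction m (cyclicToGalois m hm c) :=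
  rfl

theorem cyclicToGalois_bijective (m : ℕ) (hm : m ≠ 0) :
    Function.Bijective (cyclicToGalois m hm) := by
  have : NeZero m := ⟨hm⟩
  have hsurj : Function.Surjective (cyclicToGalois m hm) := fun σ => by
    obtain ⟨i, rfl⟩ := (FiniteField.bijective_frobeniusAlgEquivOfAlgebraic_pow (ZMod 2)
      (GaloisField 2 m)).2 σ
    refine ⟨Multiplicative.ofAdd ((i : ℕ) : ZMod m), ?_⟩
    have hi := ZMod.lift_coe m (f := ⟨zmultiplesHom _ (Additive.ofMul (frob m)), by
      simp [← ofMul_pow, frob_pow m hm]⟩) (i : ℕ)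
    rw [Int.cast_natCast] at hi
    exact (congrArg Additive.toMul hi).trans (by simp [frob])
  refine (Nat.bijective_iff_surjective_and_card _).2 ⟨hsurj, ?_⟩
  rw [IsGalois.card_aut_eq_finrank, GaloisField.finrank 2 hm]
  simp

/-- The semilinear map `x ↦ A (σ x)` of the plane `𝔽_{2^m}²`. -/
def semilinearMap {m : ℕ} (A : Matrix (Fin 2) (Fin 2) (GaloisField 2 m))
    (σ : GaloisField 2 m ≃ₐ[ZMod 2] GaloisField 2 m) :
    (Fin 2 → GaloisField 2 m) →ₗ[ZMod 2] (Fin 2 → GaloisField 2 m) where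
  toFun x := A *ᵥ (σ ∘ x)
  map_add' x y := by rw [← Matrix.mulVec_add]; congr 1; ext; simp
  map_smul' c x := by
    rw [RingHom.id_apply, ← Matrix.mulVec_smul]; congr 1; ext; simp

theorem semilinearMap_apply {m : ℕ} (A : Matrix (Fin 2) (Fin 2) (GaloisField 2 m))
    (σ : GaloisField 2 m ≃ₐ[ZMod 2] GaloisField 2 m) (x : Fin 2 → GaloisField 2 m) :
    semilinearMap A σ x = A *ᵥ (σ ∘ x) := rfl

theorem semilinearMap_smul {m : ℕ} (A : Matrix (Fin 2) (Fin 2) (GaloisField 2 m))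
    (σ : GaloisField 2 m ≃ₐ[ZMod 2] GaloisField 2 m) (a : GaloisField 2 m)
    (x : Fin 2 → GaloisField 2 m) :
    semilinearMap A σ (a • x) = σ a • semilinearMap A σ x := by
  rw [semilinearMap_apply, semilinearMap_apply, ← Matrix.mulVec_smul]
  congr 1
  ext
  simp

theorem traceDetForm_semilinearMap {m : ℕ} (A : Matrix (Fin 2) (Fin 2) (GaloisField 2 m))
    (σ : GaloisField 2 m ≃ₐ[ZMod 2] GaloisField 2 m) (x y : Fin 2 → GaloisField 2 m) :
    traceDetForm m (semilinearMap A σ x) (semilinearMap A σ y) =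
      Algebra.trace (ZMod 2) _ (A.det * σ (x 0 * y 1 - x 1 * y 0)) := by
  rw [traceDetForm]
  congr 1
  simp only [semilinearMap_apply, Matrix.mulVec, dotProduct, Fin.sum_univ_two, Matrix.det_fin_two,
    Function.comp_apply, map_sub, map_mul]
  ring

/-- An additive injection of the plane that maps lines into lines is semilinear. -/
theorem exists_eq_semilinearMap {m : ℕ}
    (h : (Fin 2 → GaloisField 2 m) →ₗ[ZMod 2] (Fin 2 → GaloisField 2 m))
    (hinj : Function.Injective h) (hline : ∀ v, ∀ a : GaloisField 2 m, ∃ b : GaloisField 2 m,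
      h (a • v) = b • h v) :
    ∃ A σ, h = semilinearMap A σ := by
  let e : Fin 2 → Fin 2 → GaloisField 2 m := fun i => Pi.single i 1
  have he : ∀ x : Fin 2 → GaloisField 2 m, x = x 0 • e 0 + x 1 • e 1 := fun x => by
    ext i; fin_cases i <;> simp [e]
  choose f hf using hline
  have hne : ∀ i, h (e i) ≠ 0 := fun i h0 => by
    have := congrFun (hinj (h0.trans h.map_zero.symm)) i
    simp [e] at this
  have hf0 : ∀ i, Function.Injective (f (e i)) := fun i a b hab => by
    have h1 : h (a • e i) = h (b • e i) := by rw [hf, hf, hab]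
    simpa [e] using congrFun (hinj h1) i
  have hf0s : ∀ i, Function.Surjective (f (e i)) := fun i => Finite.surjective_of_injective (hf0 i)
  -- The images of the two axes are distinct lines.
  have hind : ∀ c d : GaloisField 2 m, c • h (e 0) = d • h (e 1) → c = 0 ∧ d = 0 := by
    intro c d hcd
    obtain ⟨a, rfl⟩ := hf0s 0 c
    obtain ⟨b, rfl⟩ := hf0s 1 d
    rw [← hf, ← hf] at hcd
    have h1 := hinj hcd
    have ha : a = 0 := by simpa [e] using congrFun h1 0
    have hb : 0 = b := by simpa [e] using congrFun h1 1
    have hz : ∀ i, f (e i) 0 = 0 := fun i => by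
      have := hf (e i) 0
      rw [zero_smul, map_zero] at this
      exact (smul_eq_zero.1 this.symm).resolve_right (hne i)
    rw [ha, ← hb, hz, hz]
    exact ⟨rfl, rfl⟩
  have hind' : ∀ c d c' d' : GaloisField 2 m,
      c • h (e 0) + d • h (e 1) = c' • h (e 0) + d' • h (e 1) → c = c' ∧ d = d' := by
    intro c d c' d' hcd
    have h1 := hind (c - c') (d' - d) (by
      rw [sub_smul, sub_smul, sub_eq_sub_iff_add_eq_add, hcd, add_comm])
    exact ⟨sub_eq_zero.1 h1.1, (sub_eq_zero.1 h1.2).symm⟩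
  -- The line of `e 0 + e 1` shows that the scalars are twisted in the same way on both axes.
  have hf1 : ∀ a, f (e 1) a = f (e 0) a := fun a => by
    have h1 := hf (e 0 + e 1) a
    rw [smul_add, map_add, map_add, smul_add, hf, hf] at h1
    have h2 := hind' _ _ _ _ h1
    rw [h2.1, h2.2]
  have hfadd : ∀ a b, f (e 0) (a + b) = f (e 0) a + f (e 0) b := fun a b => by
    apply smul_left_injective _ (hne 0)
    dsimp only
    rw [add_smul, ← hf, ← hf, ← hf, add_smul, map_add]
  -- The line of `e 0 + a • e 1` shows that the twist is multiplicative.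
  have hfmul : ∀ b a, f (e 0) (b * a) = f (e 0) b * f (e 0) a := fun b a => by
    have h1 := hf (e 0 + a • e 1) b
    rw [smul_add, smul_smul, map_add, map_add, smul_add, hf, hf, hf, hf1, hf1, smul_smul] at h1
    have h2 := hind' _ _ _ _ h1
    rw [h2.1, h2.2]
  have hfone : f (e 0) 1 = 1 := by
    apply smul_left_injective _ (hne 0)
    dsimp only
    rw [← hf, one_smul, one_smul]
  let σ₀ : GaloisField 2 m →+* GaloisField 2 m :=
    RingHom.mk' ⟨⟨f (e 0), hfone⟩, hfmul⟩ hfadd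
  let σ₁ : GaloisField 2 m →ₐ[ZMod 2] GaloisField 2 m :=
    { σ₀ with
      commutes' := RingHom.congr_fun
        (Subsingleton.elim (σ₀.comp (algebraMap (ZMod 2) (GaloisField 2 m))) (algebraMap _ _)) }
  refine ⟨Matrix.of fun i j => h (e j) i,
    AlgEquiv.ofBijective σ₁ ⟨hf0 0, hf0s 0⟩, LinearMap.ext fun x => ?_⟩
  rw [semilinearMap_apply]
  conv_lhs => rw [he x, map_add, hf, hf, hf1]
  ext i
  simp only [Matrix.mulVec, dotProduct, Fin.sum_univ_two, Matrix.of_apply, Pi.add_apply,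
    Pi.smul_apply, smul_eq_mul, Function.comp_apply]
  rw [mul_comm, mul_comm (f (e 0) (x 1))]
  rfl

theorem det_eq_one_of_traceDetForm_semilinearMap {m : ℕ}
    {A : Matrix (Fin 2) (Fin 2) (GaloisField 2 m)} {σ : GaloisField 2 m ≃ₐ[ZMod 2] GaloisField 2 m}
    (h : ∀ x y, traceDetForm m (semilinearMap A σ x) (semilinearMap A σ y) = traceDetForm m x y) :
    A.det = 1 := by
  suffices h1 : σ.symm A.det - 1 = 0 by
    rw [sub_eq_zero, AlgEquiv.symm_apply_eq, map_one] at h1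
    exact h1
  refine GaloisField.eq_zero_of_trace_mul_eq_zero fun z => ?_
  have h1 := h ![z, 0] ![0, 1]
  rw [traceDetForm_semilinearMap, ← Algebra.trace_eq_of_algEquiv σ.symm, map_mul] at h1
  simpa [traceDetForm, sub_mul, sub_eq_zero] using h1

section

variable {m : ℕ} {𝒰 : Set (Submodule (ZMod 2) (SympSpace m))}
  {φ : (Fin 2 → GaloisField 2 m) ≃ₗ[ZMod 2] SympSpace m}

/-- A symplectic transformation stabilizes the spread if and only if it maps every line of the
plane into a line; it then permutes the lines by finiteness. -/
theorem IsSpreadCoordinates.mem_spreadStabilizer_iff (hφ : IsSpreadCoordinates 𝒰 φ) (A : Sp m) :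
    A ∈ spreadStabilizer 𝒰 ↔ ∀ v : Fin 2 → GaloisField 2 m, ∀ a : GaloisField 2 m,
      ∃ b : GaloisField 2 m, φ.symm (A.1 *ᵥ φ (a • v)) = b • φ.symm (A.1 *ᵥ φ v) := by
  have hline : ∀ v : Fin 2 → GaloisField 2 m, v ≠ 0 → ∃ U ∈ 𝒰,
      (U : Set (SympSpace m)) = Set.range fun a : GaloisField 2 m => φ (a • v) := fun v hv => by
    let U : Submodule (ZMod 2) (SympSpace m) := LinearMap.range (φ.toLinearMap.comp
      ((LinearMap.toSpanSingleton (GaloisField 2 m) _ v).restrictScalars (ZMod 2)))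
    have hU : (U : Set (SympSpace m)) = Set.range fun a : GaloisField 2 m => φ (a • v) := by
      ext; simp [U]
    exact ⟨U, (hφ.mem_iff U).2 ⟨v, hv, hU⟩, hU⟩
  have hA0 : ∀ v : Fin 2 → GaloisField 2 m, v ≠ 0 → φ.symm (A.1 *ᵥ φ v) ≠ 0 := fun v hv h => by
    rw [LinearEquiv.map_eq_zero_iff] at h
    exact hv (by simpa using A.mulVec_injective (h.trans (Matrix.mulVec_zero A.1).symm))
  constructor
  · intro hA v a
    by_cases hv : v = 0
    · exact ⟨0, by simp [hv]⟩
    obtain ⟨U, hU𝒰, hU⟩ := hline v hv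
    obtain ⟨w, -, hw⟩ := (hφ.mem_iff _).1 ((hA U).2 hU𝒰)
    have hmem : ∀ c : GaloisField 2 m, ∃ d : GaloisField 2 m, d • w = φ.symm (A.1 *ᵥ φ (c • v)) :=
      fun c => by
        have h1 : A.1 *ᵥ φ (c • v) ∈ sympImage A U :=
          ⟨φ (c • v), by rw [hU]; exact ⟨c, rfl⟩, rfl⟩
        rw [← SetLike.mem_coe, hw] at h1
        obtain ⟨d, hd⟩ := h1
        exact ⟨d, by simp [← hd]⟩
    obtain ⟨c, hc⟩ := hmem 1
    obtain ⟨d, hd⟩ := hmem a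
    rw [one_smul] at hc
    have hc0 : c ≠ 0 := by
      rintro rfl
      exact hA0 v hv (by rw [← hc, zero_smul])
    exact ⟨d * c⁻¹, by rw [← hd, ← hc, smul_smul, inv_mul_cancel_right₀ hc0]⟩
  · intro hA
    have hmaps : Set.MapsTo (sympImage A) 𝒰 𝒰 := fun U hU => by
      obtain ⟨v, hv, hUv⟩ := (hφ.mem_iff U).1 hU
      refine (hφ.mem_iff _).2 ⟨_, hA0 v hv, ?_⟩
      choose b hb using hA v
      have hbinj : Function.Injective b := fun c d hcd => by
        have h1 : φ.symm (A.1 *ᵥ φ (c • v)) = φ.symm (A.1 *ᵥ φ (d • v)) := by rw [hb, hb, hcd]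
        exact smul_left_injective _ hv (φ.injective (A.mulVec_injective (φ.symm.injective h1)))
      have hbsurj : Function.Surjective b := Finite.surjective_of_injective hbinj
      ext z
      rw [sympImage, Submodule.map_coe, hUv]
      simp only [Set.mem_image, Set.mem_range, exists_exists_eq_and, Matrix.mulVecLin_apply]
      constructor
      · rintro ⟨c, rfl⟩
        exact ⟨b c, by rw [← hb, φ.apply_symm_apply]⟩
      · rintro ⟨d, rfl⟩
        obtain ⟨c, rfl⟩ := hbsurj d
        exact ⟨c, by rw [← hb, φ.apply_symm_apply]⟩
    have hinj : Function.Injective (sympImage A) := Submodule.map_injective_of_injective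
      (f := Matrix.mulVecLin A.1) A.mulVec_injective
    -- An injective self-map of a finite set is onto.
    have hsurj : Set.SurjOn (sympImage A) 𝒰 𝒰 :=
      (Set.MapsTo.restrict_surjective_iff hmaps).1
        (Finite.surjective_of_injective (hmaps.restrict_inj.2 hinj.injOn))
    intro U
    refine ⟨fun hU => ?_, fun hU => hmaps hU⟩
    obtain ⟨U', hU', h⟩ := hsurj hU
    exact hinj h ▸ hU'

/-- The action of `SL(2, 2^m) ⋊ C_m` on the symplectic space by semilinear maps. -/
def IsSpreadCoordinates.semilinearHom (hφ : IsSpreadCoordinates 𝒰 φ) (hm : m ≠ 0) :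
    SL2 m ⋊[cyclicAction m hm] Multiplicative (ZMod m) →* Sp m :=
  MonoidHom.mk' (fun g => Sp.ofLinearMap
    (φ.toLinearMap.comp ((semilinearMap g.left.1 (cyclicToGalois m hm g.right)).comp
      φ.symm.toLinearMap)) fun x y => by
        simp only [LinearMap.comp_apply, LinearEquiv.coe_coe, hφ.sympForm_apply,
          traceDetForm_semilinearMap, g.left.2, one_mul]
        rw [Algebra.trace_eq_of_algEquiv, ← traceDetForm, ← hφ.sympForm_apply]
        simp) fun g h => by
    refine Sp.ext_mulVec fun x => ?_
    rw [Sp.mul_mulVec]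
    simp only [Sp.ofLinearMap_mulVec, LinearMap.comp_apply, LinearEquiv.coe_coe,
      LinearEquiv.symm_apply_apply, semilinearMap_apply, SemidirectProduct.mul_left,
      SemidirectProduct.mul_right, cyclicAction_apply, map_mul]
    congr 1
    have hB : ((galoisAction m (cyclicToGalois m hm g.right) h.left : SL2 m) : Matrix _ _ _) =
      h.left.1.map (cyclicToGalois m hm g.right) := rfl
    rw [Matrix.SpecialLinearGroup.coe_mul, ← Matrix.mulVec_mulVec, hB]
    congr 1
    ext i
    fin_cases i <;> simp [Matrix.mulVec, dotProduct]

theorem IsSpreadCoordinates.semilinearHom_mulVec (hφ : IsSpreadCoordinates 𝒰 φ) (hm : m ≠ 0)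
    (g : SL2 m ⋊[cyclicAction m hm] Multiplicative (ZMod m)) (x : Fin 2 → GaloisField 2 m) :
    (hφ.semilinearHom hm g).1 *ᵥ φ x =
      φ (semilinearMap g.left.1 (cyclicToGalois m hm g.right) x) := by
  simp [semilinearHom]

theorem IsSpreadCoordinates.semilinearHom_injective (hφ : IsSpreadCoordinates 𝒰 φ) (hm : m ≠ 0) :
    Function.Injective (hφ.semilinearHom hm) := by
  rw [injective_iff_map_eq_one]
  intro g hg
  have h1 : ∀ x, semilinearMap g.left.1 (cyclicToGalois m hm g.right) x = x := fun x => by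
    apply φ.injective
    rw [← hφ.semilinearHom_mulVec, hg, Submonoid.coe_one, Matrix.one_mulVec]
  have hleft : g.left = 1 := by
    apply Subtype.ext
    refine Matrix.ext_of_mulVec_single fun i => ?_
    have h2 := h1 (Pi.single i 1)
    have h3 : cyclicToGalois m hm g.right ∘ Pi.single i 1 = Pi.single i 1 := by
      ext j
      by_cases hj : j = i
      · subst hj; simp
      · simp [hj]
    rw [semilinearMap_apply, h3] at h2
    rw [h2, Matrix.SpecialLinearGroup.coe_one, Matrix.one_mulVec]
  have hright : g.right = 1 := by
    apply (cyclicToGalois_bijective m hm).1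
    ext z
    have h2 := congrFun (h1 ![z, 0]) 0
    simpa [semilinearMap_apply, hleft, Matrix.mulVec, dotProduct] using h2
  exact SemidirectProduct.ext hleft hright

theorem IsSpreadCoordinates.range_semilinearHom (hφ : IsSpreadCoordinates 𝒰 φ) (hm : m ≠ 0) :
    (hφ.semilinearHom hm).range = spreadStabilizer 𝒰 := by
  ext A
  rw [hφ.mem_spreadStabilizer_iff]
  constructor
  · rintro ⟨g, rfl⟩ v a
    exact ⟨cyclicToGalois m hm g.right a, by
      simp only [hφ.semilinearHom_mulVec, LinearEquiv.symm_apply_apply, semilinearMap_smul]⟩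
  · intro hA
    let h : (Fin 2 → GaloisField 2 m) →ₗ[ZMod 2] (Fin 2 → GaloisField 2 m) :=
      φ.symm.toLinearMap.comp ((Matrix.mulVecLin A.1).comp φ.toLinearMap)
    have hinj : Function.Injective h :=
      φ.symm.injective.comp (A.mulVec_injective.comp φ.injective)
    obtain ⟨B, σ, hB⟩ := exists_eq_semilinearMap h hinj hA
    have hdet : B.det = 1 := by
      refine det_eq_one_of_traceDetForm_semilinearMap (σ := σ) fun x y => ?_
      rw [← hB, ← hφ.sympForm_apply]
      simp [h, sympForm_mulVec, hφ.sympForm_apply]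
    obtain ⟨c, rfl⟩ := (cyclicToGalois_bijective m hm).2 σ
    refine ⟨⟨⟨B, hdet⟩, c⟩, Sp.ext_mulVec fun x => ?_⟩
    obtain ⟨x, rfl⟩ := φ.surjective x
    rw [hφ.semilinearHom_mulVec, ← hB]
    simp [h]

/-- The stabilizer of a regular symplectic spread is the group of all semilinear maps of the plane
`𝔽_{2^m}²` whose matrix has determinant one. -/
theorem IsSpreadCoordinates.nonempty_mulEquiv (hφ : IsSpreadCoordinates 𝒰 φ) (hm : m ≠ 0) :
    Nonempty (spreadStabilizer 𝒰 ≃*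
      SL2 m ⋊[cyclicAction m hm] Multiplicative (ZMod m)) :=
  ⟨((MonoidHom.ofInjective (hφ.semilinearHom_injective hm)).trans
    (MulEquiv.subgroupCongr (hφ.range_semilinearHom hm))).symm⟩

end

/-! ### Shears and the failure of the strong Gelfand property -/

/-- A linear endomorphism of `𝔽_{2^m}` over `𝔽₂` that is self-adjoint for the trace form. -/
def IsTraceSelfAdjoint {m : ℕ} (a : GaloisField 2 m →ₗ[ZMod 2] GaloisField 2 m) : Prop :=
  ∀ p q, Algebra.trace (ZMod 2) (GaloisField 2 m) (a p * q) =
    Algebra.trace (ZMod 2) (GaloisField 2 m) (p * a q)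

/-- The shear `(p, q) ↦ (p + a q, q)`. -/
def upperShear {m : ℕ} (a : GaloisField 2 m →ₗ[ZMod 2] GaloisField 2 m) :
    (Fin 2 → GaloisField 2 m) →ₗ[ZMod 2] (Fin 2 → GaloisField 2 m) where
  toFun x := ![x 0 + a (x 1), x 1]
  map_add' x y := by ext i; fin_cases i <;> simp [add_add_add_comm]
  map_smul' c x := by ext i; fin_cases i <;> simp

/-- The shear `(p, q) ↦ (p, q + b p)`. -/
def lowerShear {m : ℕ} (b : GaloisField 2 m →ₗ[ZMod 2] GaloisField 2 m) :
    (Fin 2 → GaloisField 2 m) →ₗ[ZMod 2] (Fin 2 → GaloisField 2 m) where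
  toFun x := ![x 0, x 1 + b (x 0)]
  map_add' x y := by ext i; fin_cases i <;> simp [add_add_add_comm]
  map_smul' c x := by ext i; fin_cases i <;> simp

theorem upperShear_apply {m : ℕ} (a : GaloisField 2 m →ₗ[ZMod 2] GaloisField 2 m)
    (x : Fin 2 → GaloisField 2 m) : upperShear a x = ![x 0 + a (x 1), x 1] := rfl

theorem lowerShear_apply {m : ℕ} (b : GaloisField 2 m →ₗ[ZMod 2] GaloisField 2 m)
    (x : Fin 2 → GaloisField 2 m) : lowerShear b x = ![x 0, x 1 + b (x 0)] := rfl

theorem IsTraceSelfAdjoint.traceDetForm_upperShear {m : ℕ}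
    {a : GaloisField 2 m →ₗ[ZMod 2] GaloisField 2 m} (ha : IsTraceSelfAdjoint a)
    (x y : Fin 2 → GaloisField 2 m) :
    traceDetForm m (upperShear a x) (upperShear a y) = traceDetForm m x y := by
  simp only [traceDetForm, upperShear_apply, Matrix.cons_val_zero, Matrix.cons_val_one, add_mul,
    mul_add, map_sub, map_add, ha (x 1) (y 1)]
  ring

theorem IsTraceSelfAdjoint.traceDetForm_lowerShear {m : ℕ}
    {b : GaloisField 2 m →ₗ[ZMod 2] GaloisField 2 m} (hb : IsTraceSelfAdjoint b)
    (x y : Fin 2 → GaloisField 2 m) :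
    traceDetForm m (lowerShear b x) (lowerShear b y) = traceDetForm m x y := by
  simp only [traceDetForm, lowerShear_apply, Matrix.cons_val_zero, Matrix.cons_val_one, add_mul,
    mul_add, map_sub, map_add, hb (x 0) (y 0)]
  ring

/-- The transformation of the plane `𝔽_{2^m}²` corresponding to a symplectic matrix. -/
def Sp.onPlane {m : ℕ} (φ : (Fin 2 → GaloisField 2 m) ≃ₗ[ZMod 2] SympSpace m) (A : Sp m) :
    (Fin 2 → GaloisField 2 m) →ₗ[ZMod 2] (Fin 2 → GaloisField 2 m) :=
  φ.symm.toLinearMap.comp ((Matrix.mulVecLin A.1).comp φ.toLinearMap)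

theorem Sp.onPlane_apply {m : ℕ} (φ : (Fin 2 → GaloisField 2 m) ≃ₗ[ZMod 2] SympSpace m)
    (A : Sp m) (v : Fin 2 → GaloisField 2 m) : A.onPlane φ v = φ.symm (A.1 *ᵥ φ v) := rfl

theorem Sp.onPlane_mul {m : ℕ} (φ : (Fin 2 → GaloisField 2 m) ≃ₗ[ZMod 2] SympSpace m)
    (A B : Sp m) (v : Fin 2 → GaloisField 2 m) :
    (A * B).onPlane φ v = A.onPlane φ (B.onPlane φ v) := by
  simp [Sp.onPlane_apply]

theorem Sp.onPlane_inv_onPlane {m : ℕ} (φ : (Fin 2 → GaloisField 2 m) ≃ₗ[ZMod 2] SympSpace m)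
    (A : Sp m) (v : Fin 2 → GaloisField 2 m) : A⁻¹.onPlane φ (A.onPlane φ v) = v := by
  rw [Sp.onPlane_apply, Sp.onPlane_apply, φ.apply_symm_apply, Sp.inv_mulVec_mulVec,
    φ.symm_apply_apply]

theorem Sp.onPlane_onPlane_inv {m : ℕ} (φ : (Fin 2 → GaloisField 2 m) ≃ₗ[ZMod 2] SympSpace m)
    (A : Sp m) (v : Fin 2 → GaloisField 2 m) : A.onPlane φ (A⁻¹.onPlane φ v) = v := by
  rw [Sp.onPlane_apply, Sp.onPlane_apply, φ.apply_symm_apply, Sp.mulVec_inv_mulVec,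
    φ.symm_apply_apply]

theorem Sp.onPlane_injective {m : ℕ} (φ : (Fin 2 → GaloisField 2 m) ≃ₗ[ZMod 2] SympSpace m)
    (A : Sp m) : Function.Injective (A.onPlane φ) :=
  Function.LeftInverse.injective (A.onPlane_inv_onPlane φ)

theorem IsSpreadCoordinates.exists_onPlane_eq {m : ℕ}
    {𝒰 : Set (Submodule (ZMod 2) (SympSpace m))}
    {φ : (Fin 2 → GaloisField 2 m) ≃ₗ[ZMod 2] SympSpace m} (hφ : IsSpreadCoordinates 𝒰 φ)
    (T : (Fin 2 → GaloisField 2 m) →ₗ[ZMod 2] (Fin 2 → GaloisField 2 m))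
    (hT : ∀ x y, traceDetForm m (T x) (T y) = traceDetForm m x y) :
    ∃ A : Sp m, ∀ v, A.onPlane φ v = T v :=
  ⟨Sp.ofLinearMap (φ.toLinearMap.comp (T.comp φ.symm.toLinearMap)) fun x y => by
    simp only [LinearMap.comp_apply, LinearEquiv.coe_coe, hφ.sympForm_apply, hT]
    simp [← hφ.sympForm_apply], fun v => by simp [Sp.onPlane_apply]⟩

/-- Let `x` be the upper shear of `a` and `y` the lower shear of `b`. A factorization
`x * y = y' * x'` with `y'`, `x'` conjugate to `y`, `x` in the stabilizer of the spread gives two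
lines `u`, `w` of the plane such that `x * y - 1` maps `u` into `w`. The hypotheses say that `b` does
not factor through `a`, and that `a` does not annihilate the image of `b + c` for a scalar `c`;
they exclude every pair of lines. -/
theorem IsSpreadCoordinates.not_isStrongGelfandSubgroup {m : ℕ}
    {𝒰 : Set (Submodule (ZMod 2) (SympSpace m))}
    {φ : (Fin 2 → GaloisField 2 m) ≃ₗ[ZMod 2] SympSpace m} (hφ : IsSpreadCoordinates 𝒰 φ)
    {a b : GaloisField 2 m →ₗ[ZMod 2] GaloisField 2 m}
    (ha : IsTraceSelfAdjoint a) (hb : IsTraceSelfAdjoint b)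
    (hab : ∀ f g : GaloisField 2 m →ₗ[ZMod 2] GaloisField 2 m, ¬ ∀ p, b p = f (a (g p)))
    (hab' : ∀ c, ¬ ∀ p, a (b p + c * p) = 0) :
    ¬ IsStrongGelfandSubgroup (spreadStabilizer 𝒰) := by
  intro hG
  obtain ⟨x, hx⟩ := hφ.exists_onPlane_eq (upperShear a) ha.traceDetForm_upperShear
  obtain ⟨y, hy⟩ := hφ.exists_onPlane_eq (lowerShear b) hb.traceDetForm_lowerShear
  obtain ⟨h, hh, k, hk, hxy⟩ := hG.exists_mul_eq_conj_mul_conj x y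
  have hline : ∀ A ∈ spreadStabilizer 𝒰, ∀ v, ∀ t : GaloisField 2 m, ∃ s : GaloisField 2 m,
      A.onPlane φ (t • v) = s • A.onPlane φ v := fun A hA => (hφ.mem_spreadStabilizer_iff A).1 hA
  let u := k.onPlane φ ![1, 0]
  let w := h.onPlane φ ![0, 1]
  have hu : u ≠ 0 := fun h0 => by
    have := congrFun (k.onPlane_injective φ (h0.trans (map_zero _).symm)) 0
    simp at this
  have hw : w ≠ 0 := fun h0 => by
    have := congrFun (h.onPlane_injective φ (h0.trans (map_zero _).symm)) 1
    simp at this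
  have hfixx : ∀ t : GaloisField 2 m, (k * x * k⁻¹).onPlane φ (t • u) = t • u := fun t => by
    obtain ⟨s, hs⟩ := hline k⁻¹ (inv_mem hk) u t
    rw [Sp.onPlane_inv_onPlane] at hs
    have h1 : x.onPlane φ (k⁻¹.onPlane φ (t • u)) = k⁻¹.onPlane φ (t • u) := by
      rw [hs, hx, upperShear_apply]; simp
    rw [Sp.onPlane_mul, Sp.onPlane_mul, h1, Sp.onPlane_onPlane_inv]
  have hfixy : ∀ t : GaloisField 2 m, (h * y * h⁻¹).onPlane φ (t • w) = t • w := fun t => by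
    obtain ⟨s, hs⟩ := hline h⁻¹ (inv_mem hh) w t
    rw [Sp.onPlane_inv_onPlane] at hs
    have h1 : y.onPlane φ (h⁻¹.onPlane φ (t • w)) = h⁻¹.onPlane φ (t • w) := by
      rw [hs, hy, lowerShear_apply]; simp
    rw [Sp.onPlane_mul, Sp.onPlane_mul, h1, Sp.onPlane_onPlane_inv]
  have himy : ∀ v, ∃ s : GaloisField 2 m, (h * y * h⁻¹).onPlane φ v = v + s • w := fun v => by
    obtain ⟨s, hs⟩ := hline h hh ![0, 1] (b (h⁻¹.onPlane φ v 0))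
    refine ⟨s, ?_⟩
    have h1 : y.onPlane φ (h⁻¹.onPlane φ v) =
        h⁻¹.onPlane φ v + b (h⁻¹.onPlane φ v 0) • ![0, 1] := by
      rw [hy, lowerShear_apply]; ext i; fin_cases i <;> simp
    rw [Sp.onPlane_mul, Sp.onPlane_mul, h1, map_add, hs, Sp.onPlane_onPlane_inv]
  have hprod : ∀ v, (x * y).onPlane φ v = ![v 0 + a (v 1 + b (v 0)), v 1 + b (v 0)] := fun v => by
    rw [Sp.onPlane_mul, hy, hx, upperShear_apply, lowerShear_apply]; simp
  have hmain : ∀ t : GaloisField 2 m, ∃ s : GaloisField 2 m,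
      a (t * u 1 + b (t * u 0)) = s * w 0 ∧ b (t * u 0) = s * w 1 := fun t => by
    obtain ⟨s, hs⟩ := himy (t • u)
    have h1 : (x * y).onPlane φ (t • u) = t • u + s • w := by
      rw [hxy, Sp.onPlane_mul, hfixx, hs]
    rw [hprod] at h1
    refine ⟨s, ?_, ?_⟩
    · simpa using congrFun h1 0
    · simpa using congrFun h1 1
  by_cases hu0 : u 0 = 0
  · -- Here `w` is the line on which `x` acts trivially, and `x` itself is conjugate to `y`.
    have hu1 : u 1 ≠ 0 := fun hu1 => hu <| by ext i; fin_cases i <;> assumption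
    obtain ⟨q, hq⟩ : ∃ q, a q ≠ 0 := by
      by_contra! h0
      exact hab' 0 fun p => h0 _
    have hw1 : w 1 = 0 := by
      obtain ⟨s, hs0, hs1⟩ := hmain (q / u 1)
      rw [hu0, mul_zero, map_zero, add_zero, div_mul_cancel₀ _ hu1] at hs0
      rw [hu0, mul_zero, map_zero] at hs1
      refine (mul_eq_zero.1 hs1.symm).resolve_left ?_
      rintro rfl
      exact hq (by rw [hs0, zero_mul])
    have hw0 : w 0 ≠ 0 := fun hw0 => hw <| by ext i; fin_cases i <;> assumption
    have hyx : ∀ v, (h * y * h⁻¹).onPlane φ v = x.onPlane φ v := fun v => by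
      have hv : v = (v 0 / w 0) • w + (v 1 / u 1) • u := by
        ext i
        fin_cases i
        · simp [hu0, hw0]
        · simp [hw1, hu1]
      have h1 := hprod ((v 1 / u 1) • u)
      rw [hxy, Sp.onPlane_mul, hfixx] at h1
      conv_lhs => rw [hv]
      rw [map_add, hfixy, h1, hx, upperShear_apply]
      ext i
      fin_cases i
      · simp [hu0, hw0, hu1]
      · simp [hu0, hw1, hu1]
    have hyx' : ∀ v, h.onPlane φ (y.onPlane φ v) = x.onPlane φ (h.onPlane φ v) := fun v => by
      rw [← hyx, Sp.onPlane_mul, Sp.onPlane_mul, Sp.onPlane_inv_onPlane]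
    refine hab
      ((LinearMap.proj 1).comp ((h⁻¹.onPlane φ).comp (LinearMap.single (ZMod 2) _ 0)))
      ((LinearMap.proj 1).comp ((h.onPlane φ).comp (LinearMap.single (ZMod 2) _ 0))) fun p => ?_
    have h1 := hyx' (Pi.single 0 p)
    have h2 : y.onPlane φ (Pi.single 0 p) = Pi.single 0 p + Pi.single 1 (b p) := by
      rw [hy, lowerShear_apply]; ext i; fin_cases i <;> simp
    have h3 : x.onPlane φ (h.onPlane φ (Pi.single 0 p)) =
        h.onPlane φ (Pi.single 0 p) + Pi.single 0 (a (h.onPlane φ (Pi.single 0 p) 1)) := by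
      rw [hx, upperShear_apply]; ext i; fin_cases i <;> simp
    rw [h2, h3, map_add, add_right_inj] at h1
    simp only [LinearMap.comp_apply, LinearMap.proj_apply, LinearMap.single_apply]
    rw [← h1, Sp.onPlane_inv_onPlane]
    simp
  · have hmain' : ∀ p, ∃ s : GaloisField 2 m,
        a (b p + u 1 / u 0 * p) = s * w 0 ∧ b p = s * w 1 := fun p => by
      obtain ⟨s, hs0, hs1⟩ := hmain (p / u 0)
      rw [div_mul_cancel₀ _ hu0] at hs0 hs1
      refine ⟨s, ?_, hs1⟩
      rw [← hs0]
      congr 1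
      ring
    have hw1 : w 1 ≠ 0 := fun hw1 => hab 0 0 fun p => by
      obtain ⟨s, -, hs⟩ := hmain' p
      simpa [hw1] using hs
    by_cases hw0 : w 0 = 0
    · refine hab' (u 1 / u 0) fun p => ?_
      obtain ⟨s, hs, -⟩ := hmain' p
      rw [hs, hw0, mul_zero]
    · refine hab (LinearMap.mulLeft (ZMod 2) (w 1 / w 0))
        (b + LinearMap.mulLeft (ZMod 2) (u 1 / u 0)) fun p => ?_
      obtain ⟨s, hs, hs'⟩ := hmain' p
      simp only [LinearMap.add_apply, LinearMap.mulLeft_apply]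
      rw [hs, hs']
      field_simp

open Module in
/-- Let `b p = p ^ 2 + √p`. The kernel of `b + c` for a scalar `c` has at most four elements, since
`r ^ 2` lies in it if and only if `r ^ 4 + c * r ^ 2 + r = 0`; and the kernel of `b` has at most two
elements, since `p ^ 4 = p` and `p ^ 2 ^ m = p` with `m` odd imply `p ^ 2 = p`. So `b` has rank at
least `m - 1 ≥ 4` and does not factor through `a p = ∑ i, Tr (v i * p) • v i`, where `v` consists
of three linearly independent elements; and if `a` annihilated the image of the self-adjoint map
`b + c`, the three elements `v i` would lie in its kernel. -/
theorem exists_isTraceSelfAdjoint_pair {m : ℕ} (hm : 5 ≤ m) (hodd : Odd m) :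
    ∃ a b : GaloisField 2 m →ₗ[ZMod 2] GaloisField 2 m,
      IsTraceSelfAdjoint a ∧ IsTraceSelfAdjoint b ∧
      (∀ f g : GaloisField 2 m →ₗ[ZMod 2] GaloisField 2 m, ¬ ∀ p, b p = f (a (g p))) ∧
      ∀ c, ¬ ∀ p, a (b p + c * p) = 0 := by
  have hm0 : m ≠ 0 := by omega
  let β : Basis (Fin m) (ZMod 2) (GaloisField 2 m) :=
    finBasisOfFinrankEq _ _ (GaloisField.finrank 2 hm0)
  let v : Fin 3 → GaloisField 2 m := fun i => β (Fin.castLE (by omega) i)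
  have hv : LinearIndependent (ZMod 2) v :=
    β.linearIndependent.comp _ (Fin.castLE_injective _)
  let T := Algebra.trace (ZMod 2) (GaloisField 2 m)
  let a : GaloisField 2 m →ₗ[ZMod 2] GaloisField 2 m :=
    ∑ i, (T.comp (LinearMap.mulLeft (ZMod 2) (v i))).smulRight (v i)
  have ha_apply : ∀ p, a p = ∑ i, T (v i * p) • v i := fun p => by simp [a]
  let b : GaloisField 2 m →ₗ[ZMod 2] GaloisField 2 m :=
    (frob m).toLinearMap + (frob m).symm.toLinearMap
  have hb_apply : ∀ p, b p = frob m p + (frob m).symm p := fun p => rfl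
  have ha : IsTraceSelfAdjoint a := fun p q => by
    rw [ha_apply, ha_apply, Finset.sum_mul, Finset.mul_sum, map_sum, map_sum]
    refine Finset.sum_congr rfl fun i _ => ?_
    rw [smul_mul_assoc, mul_smul_comm, map_smul, map_smul, smul_eq_mul, smul_eq_mul, mul_comm,
      mul_comm (v i) p]
  have hb : IsTraceSelfAdjoint b := fun p q => by
    rw [hb_apply, hb_apply, add_mul, mul_add, map_add, map_add, add_comm]
    congr 1
    · rw [← Algebra.trace_eq_of_algEquiv (frob m), map_mul, AlgEquiv.apply_symm_apply]
    · rw [← Algebra.trace_eq_of_algEquiv (frob m).symm, map_mul, AlgEquiv.symm_apply_apply]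
  have hrange : LinearMap.range a ≤ Submodule.span (ZMod 2) (Set.range v) := by
    rintro _ ⟨p, rfl⟩
    rw [ha_apply]
    exact Submodule.sum_mem _ fun i _ => Submodule.smul_mem _ _ (Submodule.subset_span ⟨i, rfl⟩)
  refine ⟨a, b, ha, hb, fun f g h => ?_, fun c h => ?_⟩
  · have h1 : finrank (ZMod 2) (LinearMap.range b) ≤ 3 := by
      have h2 : LinearMap.range b ≤ (Submodule.span (ZMod 2) (Set.range v)).map f := by
        rintro _ ⟨p, rfl⟩
        exact ⟨a (g p), hrange ⟨_, rfl⟩, (h p).symm⟩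
      calc finrank (ZMod 2) (LinearMap.range b)
          ≤ finrank (ZMod 2) ((Submodule.span (ZMod 2) (Set.range v)).map f) :=
            Submodule.finrank_mono h2
        _ ≤ finrank (ZMod 2) (Submodule.span (ZMod 2) (Set.range v)) :=
            Submodule.finrank_map_le _ _
        _ = 3 := by rw [finrank_span_eq_card hv, Fintype.card_fin]
    have h2 : finrank (ZMod 2) (LinearMap.ker b) ≤ 1 := by
      refine (Submodule.finrank_mono fun p hp => ?_).trans
        (finrank_span_singleton (K := ZMod 2) (one_ne_zero (α := GaloisField 2 m))).le
      rw [LinearMap.mem_ker, hb_apply, CharTwo.add_eq_zero, AlgEquiv.eq_symm_apply, frob_apply,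
        frob_apply] at hp
      have hp4 : ∀ k, p ^ 4 ^ k = p := fun k => by
        induction k with
        | zero => simp
        | succ k ih => rw [pow_succ, pow_mul, ih, show 4 = 2 * 2 from rfl, pow_mul, hp]
      obtain ⟨k, rfl⟩ := hodd
      have hcard : p ^ 2 ^ (2 * k + 1) = p := by
        have := Fintype.ofFinite (GaloisField 2 (2 * k + 1))
        have := FiniteField.pow_card p
        rwa [← Nat.card_eq_fintype_card, GaloisField.card 2 _ hm0] at this
      rw [pow_succ, pow_mul, pow_mul, show 2 ^ 2 = 4 from rfl, hp4] at hcard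
      have hp01 : p * (p - 1) = 0 := by rw [mul_sub, ← sq, hcard, mul_one, sub_self]
      rcases mul_eq_zero.1 hp01 with h0 | h0
      · rw [h0]; exact zero_mem _
      · rw [sub_eq_zero.1 h0]; exact Submodule.mem_span_singleton_self _
    have h3 := LinearMap.finrank_range_add_finrank_ker b
    rw [GaloisField.finrank 2 hm0] at h3
    omega
  · let B := b + LinearMap.mulLeft (ZMod 2) c
    have hB : ∀ p, B p = b p + c * p := fun p => rfl
    have hBself : IsTraceSelfAdjoint B := fun p q => by
      rw [hB, hB, add_mul, mul_add, map_add, map_add, hb]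
      congr 2
      ring
    have hvker : ∀ i, B (v i) = 0 := fun i => by
      refine GaloisField.eq_zero_of_trace_mul_eq_zero fun p => ?_
      rw [hBself]
      have h1 := h p
      rw [ha_apply, ← hB] at h1
      exact Fintype.linearIndependent_iff.1 hv _ h1 i
    have h3 : 3 ≤ finrank (ZMod 2) (LinearMap.ker B) := by
      have h1 : Submodule.span (ZMod 2) (Set.range v) ≤ LinearMap.ker B := by
        rw [Submodule.span_le]
        rintro _ ⟨i, rfl⟩
        exact hvker i
      have h2 := Submodule.finrank_mono h1
      rwa [finrank_span_eq_card hv, Fintype.card_fin] at h2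
    have h8 : 8 ≤ Nat.card (LinearMap.ker B) := by
      rw [natCard_eq_pow_finrank (K := ZMod 2), Nat.card_zmod]
      exact Nat.pow_le_pow_right (n := 2) (by norm_num) h3
    -- The square roots of the elements of the kernel are roots of a quartic.
    let P : Polynomial (GaloisField 2 m) := .X ^ 4 + .C c * .X ^ 2 + .X
    have hPdeg : P.natDegree = 4 := by simp only [P]; compute_degree!
    have hP0 : P ≠ 0 := by
      intro h0
      simp [h0] at hPdeg
    have hroot : ∀ p ∈ LinearMap.ker B, (frob m).symm p ∈ P.rootSet (GaloisField 2 m) := by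
      intro p hp
      rw [Polynomial.mem_rootSet]
      refine ⟨hP0, ?_⟩
      obtain ⟨r, rfl⟩ := (frob m).surjective p
      rw [LinearMap.mem_ker, hB, hb_apply, AlgEquiv.symm_apply_apply, frob_apply, frob_apply] at hp
      rw [AlgEquiv.symm_apply_apply]
      simp only [P, map_add, map_mul, map_pow, Polynomial.aeval_X, Polynomial.aeval_C,
        Algebra.algebraMap_self_apply]
      rw [← hp]
      ring
    have h4 : Nat.card (LinearMap.ker B) ≤ 4 := by
      rw [← hPdeg]
      refine le_trans ?_ (P.ncard_rootSet_le (GaloisField 2 m))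
      rw [← Nat.card_coe_set_eq]
      exact Nat.card_le_card_of_injective (fun p => ⟨_, hroot p.1 p.2⟩) fun p q hpq =>
        Subtype.ext ((frob m).symm.injective (congrArg Subtype.val hpq))
    omega

end

theorem mainTheorem4 (n m : ℕ) (hm : m.Prime) (hnm : n = 2 * m) (hn : 6 < n) :
    (∃ 𝒰 : Set (Submodule (ZMod 2) (SympSpace m)), IsRegularSymplecticSpread m 𝒰) ∧
    ∀ 𝒰 : Set (Submodule (ZMod 2) (SympSpace m)), IsRegularSymplecticSpread m 𝒰 →
      Nonempty (spreadStabilizer 𝒰 ≃* SL2 m ⋊[cyclicAction m hm.ne_zero] Multiplicative (ZMod m)) ∧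
      ¬ IsStrongGelfandSubgroup (spreadStabilizer 𝒰) := by
  have hodd : Odd m := hm.odd_of_ne_two (by omega)
  have hm5 : 5 ≤ m := by
    obtain ⟨k, rfl⟩ := hodd
    omega
  refine ⟨exists_isRegularSymplecticSpread hm.ne_zero, fun 𝒰 h𝒰 => ?_⟩
  obtain ⟨φ, hφ⟩ := h𝒰.exists_coordinates hm.ne_zero
  obtain ⟨a, b, ha, hb, hab, hab'⟩ := exists_isTraceSelfAdjoint_pair hm5 hodd
  exact ⟨hφ.nonempty_mulEquiv hm.ne_zero, hφ.not_isStrongGelfandSubgroup ha hb hab hab'⟩
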